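/- Let $q$ and $x$ be indeterminates. For an abelian profinite group $G$ let $\mathcal O(G)$ be the set of its open subgroups. For $V,W\in\mathcal O(G)$ with $V\subseteq W$ let $(W:V)$ be the index of $V$ in $W$ and let $\varphi_V(G/W)$ be the number of $V$-fixed points of $G/W$. Let $\zeta_G^q$ be the $\mathcal O(G)\times\mathcal O(G)$ matrix with entries $\zeta_G^q(V,W)=\varphi_V(G/W)\,q^{(W:V)-1}$ if $V\subseteq W$ and $0$ otherwise; it is invertible over every commutative $\mathbb Q[q]$-algebra, and $\mu_G^q$ denotes its inverse. For a commutative $\mathbb Q[q]$-algebra $A$ let $\varphi_G^q:A^{\mathcal O(G)}\to A^{\mathcal O(G)}$, $\mathbf x\mapsto\zeta_G^q\mathbf x$. For an open subgroup $U$ of $G$ let $\mathcal F_U^G:A^{\mathcal O(G)}\to A^{\mathcal O(U)}$ be given by $\mathcal F_U^G(\mathbf x)(W)=\mathbf x(W)$ for open $W\subseteq U$, and define the $q$-restriction $$q\text{-}\mathrm{Res}_U^G=(\varphi_U^q)^{-1}\circ\mathcal F_U^G\circ\varphi_G^q.$$ Let $\hat C$ be the profinite completion of the infinite cyclic group $C$,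 and let $\hat C^n$ ($n\ge 1$) be its unique open subgroup of index $n$. Define the $q$-necklace polynomials $$M^q(x,n)=\sum_{d\mid n}\mu^q_{\hat C}(\hat C^n,\hat C^d)\,q^{d-1}x^d\in\mathbb Q[q][x],$$ viewed together as the vector $M^q(x)$ over $A=\mathbb Q[q][x]$ whose component at $\hat C^n$ is $M^q(x,n)$. For $r\ge 1$ let $f_r^q=q\text{-}\mathrm{Res}^{\hat C}_{\hat C^r}$, where the $n$-th component of a vector indexed by $\mathcal O(\hat C^r)$ is its component at the open subgroup $\hat C^{rn}$ of index $n$ in $\hat C^r$. Then there are polynomials $Q_{r,n,d}(q)\in\mathbb Q[q]$ ($r,n\ge 1$, $d\mid n$), which are numerical (that is, take integer values at all integers), such that for all $r,n\ge 1$ $$\bigl(f_r^q(M^q(x))\bigr)_n=\sum_{d\mid n}Q_{r,n,d}(q)\,M^q(x^r,d)\qquad\text{in }\mathbb Q[q][x].$$ -/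

import Mathlib

open Polynomial

set_option linter.unusedSectionVars false

noncomputable section

namespace QNecklace

section General

/-! Throughout this section `G` is an abelian compact topological group (for instance an abelian
profinite group), so that the poset `𝒪(G)` of conjugacy classes of open subgroups is the set of
open subgroups, with `V ≼ W` (meaning `[W]` is above `[V]`) iff `W ⊆ V`. -/

variable {G : Type*} [CommGroup G] [TopologicalSpace G] [IsTopologicalGroup G] [CompactSpace G]

/-- `φ_V(G/W)`: the number of `V`-fixed points of the `G`-set `G/W`. -/
def fixedCount (V W : OpenSubgroup G) : ℕ :=
  Nat.card (MulAction.fixedPoints V.toSubgroup (G ⧸ W.toSubgroup))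

/-- `(W : V) = (G : V) / (G : W)`, the index of `V` in `W`, for `V ≤ W`. -/
def relIdx (W V : OpenSubgroup G) : ℕ := V.toSubgroup.relIndex W.toSubgroup

open Classical in
/-- The `(V, W)` entry of the matrix `ζ_G^q`, over a commutative ring `A` with a
distinguished element `q`. -/
def zeta {A : Type*} [CommRing A] (q : A) (V W : OpenSubgroup G) : A :=
  if V ≤ W then (fixedCount V W : A) * q ^ (relIdx W V - 1) else 0

instance finiteIndex_open (V : OpenSubgroup G) : V.toSubgroup.FiniteIndex :=
  Subgroup.finiteIndex_of_finite_quotient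

theorem finite_Ici (V : OpenSubgroup G) : (Set.Ici V).Finite := by
  have hf : Function.Injective (fun (W : Set.Ici V) =>
      ((QuotientGroup.mk : G → G ⧸ V.toSubgroup) '' (W.1 : Set G))) := by
    rintro ⟨W, hW⟩ ⟨W', hW'⟩ h
    have key : ∀ U : OpenSubgroup G, V ≤ U → ∀ g : G,
        g ∈ U ↔ (g : G ⧸ V.toSubgroup) ∈
          ((QuotientGroup.mk : G → G ⧸ V.toSubgroup) '' (U : Set G)) := by
      intro U hU g
      refine ⟨fun hg => ⟨g, hg, rfl⟩, ?_⟩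
      rintro ⟨u, hu, hug⟩
      have h1 : u⁻¹ * g ∈ V := QuotientGroup.eq.1 hug
      have h2 := mul_mem (show u ∈ U from hu) (hU h1)
      simpa using h2
    have h' : ((QuotientGroup.mk : G → G ⧸ V.toSubgroup) '' (W : Set G)) =
      ((QuotientGroup.mk : G → G ⧸ V.toSubgroup) '' (W' : Set G)) := h
    apply Subtype.ext
    apply OpenSubgroup.ext
    intro g
    rw [key W hW, key W' hW', h']
  exact Set.finite_coe_iff.1 (Finite.of_injective _ hf)

/-- Multiplication of column vectors by the matrix `ζ_G^q`, i.e. the `q`-deformed ghost map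
`φ^q : A^{𝒪(G)} → Gh(G, A)`. Each row of the matrix has finite support. -/
def ghost {A : Type*} [CommRing A] (q : A) :
    (OpenSubgroup G → A) →ₗ[A] (OpenSubgroup G → A) where
  toFun x V := ∑ W ∈ (finite_Ici V).toFinset, zeta q V W * x W
  map_add' x y := by ext V; simp [mul_add, Finset.sum_add_distrib]
  map_smul' a x := by ext V; simp [Finset.mul_sum, mul_left_comm]

theorem fixedCount_self (V : OpenSubgroup G) : fixedCount V V = V.toSubgroup.index := by
  have h : MulAction.fixedPoints V.toSubgroup (G ⧸ V.toSubgroup) = Set.univ := by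
    rw [Set.eq_univ_iff_forall]
    intro x
    obtain ⟨g, rfl⟩ := QuotientGroup.mk_surjective x
    rintro ⟨v, hv⟩
    change (QuotientGroup.mk (v * g) : G ⧸ V.toSubgroup) = QuotientGroup.mk g
    rw [QuotientGroup.eq]
    simpa [mul_comm, mul_assoc] using hv
  rw [fixedCount, h, Subgroup.index]
  exact Nat.card_congr (Equiv.Set.univ _)

theorem isUnit_zeta_self {A : Type*} [CommRing A] [Algebra ℚ A] (q : A) (V : OpenSubgroup G) :
    IsUnit (zeta q V V) := by
  have h0 : ((V.toSubgroup.index : ℕ) : ℚ) ≠ 0 :=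
    Nat.cast_ne_zero.2 Subgroup.FiniteIndex.index_ne_zero
  have h : zeta q V V = algebraMap ℚ A (V.toSubgroup.index : ℚ) := by
    simp [zeta, relIdx, fixedCount_self]
  rw [h]
  exact (IsUnit.mk0 _ h0).map _

theorem index_lt {V W : OpenSubgroup G} (h : V < W) :
    W.toSubgroup.index < V.toSubgroup.index := by
  have hle : V.toSubgroup ≤ W.toSubgroup := h.le
  have h1 := Subgroup.relIndex_mul_index hle
  have hW : 0 < W.toSubgroup.index := Nat.pos_of_ne_zero Subgroup.FiniteIndex.index_ne_zero
  have hV : 0 < V.toSubgroup.index := Nat.pos_of_ne_zero Subgroup.FiniteIndex.index_ne_zero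
  have h2 : V.toSubgroup.relIndex W.toSubgroup ≠ 1 := by
    intro h3
    exact absurd (Subgroup.relIndex_eq_one.1 h3) (not_le_of_gt h)
  have h3 : V.toSubgroup.relIndex W.toSubgroup ≠ 0 := by
    intro h4
    rw [h4] at h1
    omega
  have h4 : 2 ≤ V.toSubgroup.relIndex W.toSubgroup := by omega
  nlinarith

theorem wf_gt : WellFounded (fun W V : OpenSubgroup G => V < W) :=
  Subrelation.wf (r := InvImage (· < ·) (fun V : OpenSubgroup G => V.toSubgroup.index))
    (fun h => index_lt h) (InvImage.wf _ wellFounded_lt)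

open Classical in
theorem ghost_apply_eq {A : Type*} [CommRing A] (q : A) (x : OpenSubgroup G → A)
    (V : OpenSubgroup G) :
    ghost q x V = zeta q V V * x V +
      ∑ W ∈ (finite_Ici V).toFinset.erase V, zeta q V W * x W := by
  rw [add_comm, Finset.sum_erase_add]
  · rfl
  · simp

/-- Over a `ℚ`-algebra, the matrix `ζ_G^q` is invertible. -/
theorem ghost_bijective {A : Type*} [CommRing A] [Algebra ℚ A] (q : A) :
    Function.Bijective (ghost (G := G) q) := by
  classical
  constructor
  · rw [injective_iff_map_eq_zero]
    intro x hx
    ext V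
    refine wf_gt.induction (C := fun V => x V = 0) V fun V ih => ?_
    have h := congrFun hx V
    rw [ghost_apply_eq, Finset.sum_eq_zero, Pi.zero_apply, add_zero] at h
    · exact (isUnit_zeta_self q V).mul_right_eq_zero.1 h
    · intro W hW
      have h1 : W ≠ V ∧ V ≤ W := by simpa using hW
      rw [ih W (lt_of_le_of_ne h1.2 (Ne.symm h1.1)), mul_zero]
  · intro y
    let x : OpenSubgroup G → A := wf_gt.fix fun V rec =>
      Ring.inverse (zeta q V V) *
        (y V - ∑ W ∈ (finite_Ici V).toFinset.erase V,
          if h : V < W then zeta q V W * rec W h else 0)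
    refine ⟨x, ?_⟩
    ext V
    have hx : x V = Ring.inverse (zeta q V V) *
        (y V - ∑ W ∈ (finite_Ici V).toFinset.erase V,
          if h : V < W then zeta q V W * x W else 0) := wf_gt.fix_eq _ V
    have hs : ∑ W ∈ (finite_Ici V).toFinset.erase V,
          (if h : V < W then zeta q V W * x W else 0) =
        ∑ W ∈ (finite_Ici V).toFinset.erase V, zeta q V W * x W := by
      refine Finset.sum_congr rfl fun W hW => ?_
      have h1 : W ≠ V ∧ V ≤ W := by simpa using hW
      rw [dif_pos (lt_of_le_of_ne h1.2 (Ne.symm h1.1))]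
    rw [hs] at hx
    rw [ghost_apply_eq, hx, ← mul_assoc, Ring.mul_inverse_cancel _ (isUnit_zeta_self q V)]
    ring

/-- The `q`-deformed ghost map over a `ℚ`-algebra, as an equivalence. -/
def ghostEquiv {A : Type*} [CommRing A] [Algebra ℚ A] (q : A) :
    (OpenSubgroup G → A) ≃ₗ[A] (OpenSubgroup G → A) :=
  LinearEquiv.ofBijective (ghost q) (ghost_bijective q)

open Classical in
/-- The `(V, W)` entry of `μ_G^q`, the inverse of the matrix `ζ_G^q`: the `V`-th component of the
inverse map applied to the `W`-th standard basis vector. -/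
def mu {A : Type*} [CommRing A] [Algebra ℚ A] (q : A) (V W : OpenSubgroup G) : A :=
  (ghostEquiv q).symm (Pi.single W 1) V

/-- The polynomial
`M_G^q(x, V) = ∑_{W ⊇ V} μ_G^q(V, W) q^{(G : W) - 1} x^{(G : W)}` in `ℚ[q][x]`. -/
def necklacePoly (V : OpenSubgroup G) : ℚ[X][X] :=
  ∑ W ∈ (finite_Ici V).toFinset,
    C (mu (X : ℚ[X]) V W * X ^ (W.toSubgroup.index - 1)) * X ^ W.toSubgroup.index

/-- An open subgroup `W` of the open subgroup `U`, viewed as an open subgroup of `G`. -/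
def toAmbient (U : OpenSubgroup G) (W : OpenSubgroup U.toSubgroup) : OpenSubgroup G where
  toSubgroup := W.toSubgroup.map U.toSubgroup.subtype
  isOpen' := U.isOpen.isOpenMap_subtype_val _ W.isOpen

instance compactSpace_open (U : OpenSubgroup G) : CompactSpace U.toSubgroup :=
  isCompact_iff_compactSpace.1 U.isClosed.isCompact

/-- The restriction `𝓕_U^G : Gh(G, A) → Gh(U, A)` on ghost rings. -/
def ghostRes {A : Type*} (U : OpenSubgroup G) (x : OpenSubgroup G → A) :
    OpenSubgroup U.toSubgroup → A :=
  fun W => x (toAmbient U W)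

/-- The `q`-restriction `q-Res_U^G = (φ_U^q)⁻¹ ∘ 𝓕_U^G ∘ φ_G^q` over a `ℚ`-algebra. -/
def qRes {A : Type*} [CommRing A] [Algebra ℚ A] (q : A) (U : OpenSubgroup G)
    (x : OpenSubgroup G → A) : OpenSubgroup U.toSubgroup → A :=
  (ghostEquiv q).symm (ghostRes U (ghostEquiv q x))

end General

section Cyclic

/-- `Ĉ`: the profinite completion of the multiplicative infinite cyclic group. -/
abbrev CHat : ProfiniteGrp.{0} :=
  ProfiniteGrp.ProfiniteCompletion.completion (GrpCat.of (Multiplicative ℤ))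

/-- The canonical map `C → Ĉ`. -/
def etaHom : Multiplicative ℤ →* CHat :=
  (ProfiniteGrp.ProfiniteCompletion.eta (GrpCat.of (Multiplicative ℤ))).hom

theorem denseRange_etaHom : DenseRange etaHom :=
  ProfiniteGrp.ProfiniteCompletion.denseRange (GrpCat.of (Multiplicative ℤ))

instance commGroupCHat : CommGroup CHat :=
  { (inferInstance : Group CHat) with
    mul_comm := fun a b => by
      have h : (fun p : CHat × CHat => p.1 * p.2) = fun p => p.2 * p.1 := by
        refine (denseRange_etaHom.prodMap denseRange_etaHom).equalizer
          (by fun_prop) (by fun_prop) ?_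
        funext p
        simp only [Function.comp, Prod.map]
        rw [← map_mul, ← map_mul, mul_comm]
      exact congrFun h (a, b) }

/-- The subgroup of `n`-th powers of `Ĉ` is open. -/
theorem isOpen_range_pow (n : ℕ+) :
    IsOpen ((powMonoidHom (n : ℕ) : CHat →* CHat).range : Set CHat) := by
  set H := (powMonoidHom (n : ℕ) : CHat →* CHat).range with hH
  have hcl : IsClosed (H : Set CHat) := by
    rw [hH, MonoidHom.coe_range]
    exact (isCompact_range (continuous_pow (n : ℕ))).isClosed
  have hn : (0 : ℤ) < n := by exact_mod_cast n.pos
  have hun : (⋃ i ∈ Finset.range (n : ℕ),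
      (fun g : CHat => (etaHom (Multiplicative.ofAdd (i : ℤ)))⁻¹ * g) ⁻¹' (H : Set CHat))
        = Set.univ := by
    have hclosed : IsClosed (⋃ i ∈ Finset.range (n : ℕ),
      (fun g : CHat => (etaHom (Multiplicative.ofAdd (i : ℤ)))⁻¹ * g) ⁻¹' (H : Set CHat)) :=
      Set.Finite.isClosed_biUnion (Finset.finite_toSet _)
        fun i _ => hcl.preimage (continuous_const.mul continuous_id)
    rw [← hclosed.closure_eq, ← Set.univ_subset_iff, ← denseRange_etaHom.closure_range]
    refine closure_mono ?_
    rintro _ ⟨k, rfl⟩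
    have h0 := Int.emod_nonneg (Multiplicative.toAdd k) hn.ne'
    have h1 := Int.emod_lt_of_pos (Multiplicative.toAdd k) hn
    simp only [Set.mem_iUnion, Set.mem_preimage]
    refine ⟨(Multiplicative.toAdd k % n).toNat, ?_, ?_⟩
    · rw [Finset.mem_range]; omega
    · refine ⟨etaHom (Multiplicative.ofAdd (Multiplicative.toAdd k / n)), ?_⟩
      rw [powMonoidHom_apply, ← map_pow, ← map_inv, ← map_mul]
      congr 1
      apply Multiplicative.toAdd.injective
      have := Int.emod_add_mul_ediv (Multiplicative.toAdd k) n
      simp only [toAdd_pow, toAdd_ofAdd, toAdd_mul, toAdd_inv, nsmul_eq_mul,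
        Int.toNat_of_nonneg h0]
      linarith
  have hfin : Finite (CHat ⧸ H) := by
    refine Finite.of_surjective (fun i : Fin n =>
      (QuotientGroup.mk (etaHom (Multiplicative.ofAdd ((i : ℕ) : ℤ))) : CHat ⧸ H)) ?_
    intro y
    obtain ⟨g, rfl⟩ := QuotientGroup.mk_surjective y
    have hg : g ∈ (Set.univ : Set CHat) := Set.mem_univ g
    rw [← hun] at hg
    simp only [Set.mem_iUnion, Set.mem_preimage, Finset.mem_range] at hg
    obtain ⟨i, hi, hg⟩ := hg
    exact ⟨⟨i, hi⟩, QuotientGroup.eq.2 hg⟩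
  have : H.FiniteIndex := Subgroup.finiteIndex_of_finite_quotient
  exact H.isOpen_of_isClosed_of_finiteIndex hcl

/-- `Ĉⁿ`, the open subgroup of `n`-th powers of `Ĉ`. -/
def cHatPow (n : ℕ+) : OpenSubgroup CHat where
  toSubgroup := (powMonoidHom (n : ℕ) : CHat →* CHat).range
  isOpen' := isOpen_range_pow n

/-- The index set of `Nr_{Ĉʳ}^q` is identified with the positive integers: the `n`-th component
is the one at the open subgroup of index `n` of `Ĉʳ`, namely `(Ĉʳ)ⁿ = Ĉʳⁿ`. -/
def cHatPowIn (r n : ℕ+) : OpenSubgroup (cHatPow r).toSubgroup :=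
  (cHatPow (r * n)).comap (cHatPow r).toSubgroup.subtype continuous_subtype_val

/-- The `q`-necklace polynomial `M^q(x, n) = M_Ĉ^q(x, Ĉⁿ)` in `ℚ[q][x]`. -/
def qNecklace (n : ℕ+) : ℚ[X][X] := necklacePoly (cHatPow n)

/-- The operator `f_r^q`, the `q`-restriction from `Ĉ` to `Ĉʳ`, on vectors over `ℚ[q][x]`; here
`q` is the inner variable `C X`. The value is a vector indexed by the positive integers. -/
def fOp (r : ℕ+) (x : OpenSubgroup CHat → ℚ[X][X]) : ℕ+ → ℚ[X][X] :=
  fun n => qRes (C X) (cHatPow r) x (cHatPowIn r n)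

open Classical in
/-- The positive divisors of a positive integer. -/
def pDivisors (n : ℕ+) : Finset ℕ+ := (Finset.Icc 1 n).filter (fun d => d ∣ n)

/-- Numerical polynomials: those taking integer values at all integers. -/
def IsNumerical (P : ℚ[X]) : Prop := ∀ k : ℤ, ∃ m : ℤ, P.eval (k : ℚ) = m

end Cyclic

end QNecklace

end

namespace QNecklace

/-! ### Integrality of the numbers `P n` defined by `∑ k ∣ n, k q^(n/k-1) P k = q^(n-1) x^n` -/

/-! Everything is compared through ghost components. Since `G` is abelian, `V ≤ W` gives `φ_V(G/W) =
(G:W)`, so for `Ĉ` and each `Ĉʳ` the ghost map is `f ↦ ∑_{d∣n} d q^(n/d-1) f(d)` (`necklaceSum`),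
injective over a domain of characteristic zero. By inversion `M^q(x)` has ghost components `q^(n-1)
x^n` (`ghost_necklacePoly`), so `f_r^q (M^q(x))` has `q^(rn-1) x^(rn)`, while `M^q(x^r)` has
`q^(n-1) x^(rn)`. The two differ by the factor `q^((r-1)n)`. This factor is produced by `Q_{r,n,d} =
M^q(q^((r-1)d), n/d)`: in the ghost of `∑_{d∣e} Q_{r,e,d} M^q(x^r, d)`, writing `e = dk` turns the
sum over `k` into the ghost of `M^q(q^((r-1)d))` at `n/d`, which is known (`necklaceSum_twist`). The
`Q_{r,n,d}` are numerical because `M^q(x,n)` is an integer at integers `q` and `x`. By induction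
this amounts to a divisibility by `n`, checked one prime power at a time
(`natCast_dvd_necklace_defect`). -/

/-- With `t = p^s u` and `p ∤ u`, the hypothesis gives `p^a ∣ k p^(s+1)`, and Fermat's congruence
for `q^u` lifts from `p` to `p^(s+1)`. -/
theorem prime_pow_dvd_mul_pow_mul_sub_pow {p : ℕ} (hp : p.Prime) (q : ℤ) {a k t : ℕ} (ht : t ≠ 0)
    (h : p ^ a ∣ k * (t * p)) : (p : ℤ) ^ a ∣ k * (q ^ (t * p) - q ^ t) := by
  obtain ⟨s, u, hu, rfl⟩ := Nat.exists_eq_pow_mul_and_not_dvd ht p hp.ne_one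
  have hc : Nat.Coprime (p ^ a) u := Nat.Coprime.pow_left _ ((hp.coprime_iff_not_dvd).2 hu)
  have h1 : p ^ a ∣ k * p ^ (s + 1) := by
    refine hc.dvd_of_dvd_mul_right ?_
    convert h using 1
    ring
  have h2 : (p : ℤ) ∣ (q ^ u) ^ p - q ^ u := by
    have := Fact.mk hp
    rw [← ZMod.intCast_eq_intCast_iff_dvd_sub]
    simp
  have h3 : (p : ℤ) ^ (s + 1) ∣ q ^ (p ^ s * u * p) - q ^ (p ^ s * u) := by
    have h := dvd_sub_pow_of_dvd_sub h2 s
    rwa [← pow_mul, ← pow_mul, ← pow_mul, show u * (p * p ^ s) = p ^ s * u * p by ring,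
      mul_comm u] at h
  have h4 : (p : ℤ) ^ a ∣ k * (p : ℤ) ^ (s + 1) := by exact_mod_cast h1
  exact h4.trans (mul_dvd_mul_left _ h3)

/-- If `p^s` is the exact power of `p` in `t`, then `s ≤ t - 1` because `s < p^s`; hence `p^s ∣
q^(t-1)`. -/
theorem prime_pow_dvd_mul_pow_sub_one {p : ℕ} (hp : p.Prime) {q : ℤ} (hq : (p : ℤ) ∣ q)
    {a k t : ℕ} (ht : t ≠ 0) (h : p ^ a ∣ k * t) : (p : ℤ) ^ a ∣ k * q ^ (t - 1) := by
  obtain ⟨s, u, hu, rfl⟩ := Nat.exists_eq_pow_mul_and_not_dvd ht p hp.ne_one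
  have hc : Nat.Coprime (p ^ a) u := Nat.Coprime.pow_left _ ((hp.coprime_iff_not_dvd).2 hu)
  have h1 : p ^ a ∣ k * p ^ s := hc.dvd_of_dvd_mul_right (by rwa [mul_assoc])
  have h4 : (p : ℤ) ^ a ∣ k * (p : ℤ) ^ s := by exact_mod_cast h1
  have hs : s < p ^ s := Nat.lt_pow_self hp.one_lt
  have hu0 : 0 < u := Nat.pos_of_ne_zero (by rintro rfl; simp at hu)
  have h5 : s ≤ p ^ s * u - 1 := by
    have : p ^ s * 1 ≤ p ^ s * u := Nat.mul_le_mul_left _ hu0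
    omega
  exact h4.trans (mul_dvd_mul_left _ ((pow_dvd_pow _ h5).trans (pow_dvd_pow_of_dvd hq _)))

theorem natCast_dvd_of_forall_prime_pow {n : ℕ} {N : ℤ}
    (h : ∀ p a : ℕ, p.Prime → a ≠ 0 → p ^ a ∣ n → (p : ℤ) ^ a ∣ N) : (n : ℤ) ∣ N := by
  rw [Int.natCast_dvd, Nat.dvd_iff_prime_pow_dvd_dvd]
  intro p a hp hd
  rcases eq_or_ne a 0 with rfl | ha
  · simp
  · have := h p a hp ha hd
    rw [← Int.natCast_dvd]
    exact_mod_cast this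

/-- For `p^a ∣ n`: if `p ∣ q`, every term is divisible by `p^a`; otherwise the expression is
compared modulo `p^a` with the relation already known at `n/p`. -/
theorem natCast_dvd_necklace_defect (q x : ℤ) (P : ℕ → ℤ) {n : ℕ} (hn : n ≠ 0)
    (hP : ∀ m < n, m ≠ 0 →
      ∑ k ∈ m.divisors, (k : ℤ) * q ^ (m / k - 1) * P k = q ^ (m - 1) * x ^ m) :
    (n : ℤ) ∣ q ^ (n - 1) * x ^ n - ∑ k ∈ n.properDivisors, (k : ℤ) * q ^ (n / k - 1) * P k := by
  refine natCast_dvd_of_forall_prime_pow fun p a hp ha hpn => ?_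
  have hquot : ∀ {m k : ℕ}, m ≠ 0 → k ∣ m → m / k ≠ 0 := fun hm hk =>
    (Nat.div_pos (Nat.le_of_dvd (Nat.pos_of_ne_zero hm) hk)
      (Nat.pos_of_dvd_of_pos hk (Nat.pos_of_ne_zero hm))).ne'
  by_cases hq : (p : ℤ) ∣ q
  · refine dvd_sub (Dvd.dvd.mul_right ?_ _) (Finset.dvd_sum fun k hk => Dvd.dvd.mul_right ?_ _)
    · simpa using prime_pow_dvd_mul_pow_sub_one hp hq (k := 1) hn (by simpa using hpn)
    · have hkn := (Nat.mem_properDivisors.1 hk).1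
      exact prime_pow_dvd_mul_pow_sub_one hp hq (hquot hn hkn) (by rwa [Nat.mul_div_cancel' hkn])
  -- Here `q` is invertible modulo `p^a`; multiplying by it removes the `-1` from the exponents.
  · have hcop : IsCoprime ((p : ℤ) ^ a) q :=
      IsCoprime.pow_left (((Nat.prime_iff_prime_int.1 hp).coprime_iff_not_dvd).2 hq)
    refine hcop.dvd_of_dvd_mul_left ?_
    obtain ⟨m, rfl⟩ : p ∣ n := (dvd_pow_self p ha).trans hpn
    have hm : m ≠ 0 := by rintro rfl; simp at hn
    have hlt : m < p * m := by nlinarith [hp.two_le, Nat.pos_of_ne_zero hm]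
    have hmul : ∀ {j k : ℕ}, j ≠ 0 → k ∣ j → q * q ^ (j / k - 1) = q ^ (j / k) := fun hj hk =>
      mul_pow_sub_one (hquot hj hk) q
    have hdiv : m.divisors = (p * m).properDivisors.filter (· ∣ m) := by
      ext k
      simp only [Nat.mem_divisors, Finset.mem_filter, Nat.mem_properDivisors]
      exact ⟨fun h => ⟨⟨h.1.mul_left p, (Nat.le_of_dvd (Nat.pos_of_ne_zero hm) h.1).trans_lt hlt⟩,
        h.1⟩, fun h => ⟨h.2, hm⟩⟩
    have key := congrArg (q * ·) (hP m hlt hm)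
    simp only [Finset.mul_sum] at key
    rw [hdiv, Finset.sum_filter] at key
    have h1 : q * (q ^ (p * m - 1) * x ^ (p * m)) = (q * x) ^ (p * m) := by
      rw [← mul_assoc, mul_pow_sub_one hn, mul_pow]
    have h2 : q * (q ^ (m - 1) * x ^ m) = (q * x) ^ m := by
      rw [← mul_assoc, mul_pow_sub_one hm, mul_pow]
    rw [h2] at key
    have h3 : (p : ℤ) ^ a ∣ (q * x) ^ (p * m) - (q * x) ^ m := by
      simpa [mul_comm m p] using prime_pow_dvd_mul_pow_mul_sub_pow hp (q * x) (k := 1) hm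
        (by simpa [mul_comm m p] using hpn)
    -- Termwise comparison of the sums at `pm` and `m`: divisors of `m` contribute a difference of
    -- powers of `q`, the remaining `k` are themselves divisible by `p^a`.
    have h4 : (p : ℤ) ^ a ∣ ∑ k ∈ (p * m).properDivisors,
        (q * ((k : ℤ) * q ^ (p * m / k - 1) * P k) -
          if k ∣ m then q * ((k : ℤ) * q ^ (m / k - 1) * P k) else 0) := by
      refine Finset.dvd_sum fun k hk => ?_
      have hk1 := (Nat.mem_properDivisors.1 hk).1
      split_ifs with hkm
      · have e1 : q * ((k : ℤ) * q ^ (p * m / k - 1) * P k) -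
            q * ((k : ℤ) * q ^ (m / k - 1) * P k) =
            (k * (q ^ (m / k * p) - q ^ (m / k))) * P k := by
          rw [← hmul hm hkm, mul_comm (m / k) p, ← Nat.mul_div_assoc p hkm, ← hmul hn hk1]
          ring
        rw [e1]
        refine Dvd.dvd.mul_right (prime_pow_dvd_mul_pow_mul_sub_pow hp q (hquot hm hkm) ?_) _
        rwa [← mul_assoc, Nat.mul_div_cancel' hkm, mul_comm]
      · obtain ⟨t, ht⟩ := hk1
        have hpt : ¬ p ∣ t := by
          rintro ⟨u, rfl⟩
          refine hkm ⟨u, Nat.eq_of_mul_eq_mul_left hp.pos ?_⟩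
          rw [ht]; ring
        have h5 : p ^ a ∣ k := (Nat.Coprime.pow_left a
          ((hp.coprime_iff_not_dvd).2 hpt)).dvd_of_dvd_mul_right (by rwa [← ht])
        have h6 : (p : ℤ) ^ a ∣ k := by exact_mod_cast h5
        rw [sub_zero]
        exact Dvd.dvd.mul_left ((h6.mul_right _).mul_right _) _
    rw [Finset.sum_sub_distrib, key] at h4
    rw [mul_sub, h1, Finset.mul_sum]
    have := dvd_sub h3 h4
    convert this using 1
    ring

theorem exists_int_eq_of_necklace_relation (q x : ℤ) (p : ℕ → ℚ)
    (h : ∀ n : ℕ, n ≠ 0 → ∑ k ∈ n.divisors, (k : ℚ) * (q : ℚ) ^ (n / k - 1) * p k =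
      (q : ℚ) ^ (n - 1) * (x : ℚ) ^ n) (n : ℕ) (hn : n ≠ 0) : ∃ m : ℤ, p n = m := by
  induction n using Nat.strong_induction_on with
  | _ n ih =>
    -- Numerators give an integer-valued function on all of `ℕ`; it agrees with `p` wherever the
    -- relations below `n` use it.
    have hint : ∀ k < n, k ≠ 0 → p k = ((p k).num : ℚ) := by
      intro k hk hk0
      obtain ⟨m, hm⟩ := ih k hk hk0
      simp [hm]
    obtain ⟨c, hc⟩ := natCast_dvd_necklace_defect q x (fun k => (p k).num) hn fun m hm hm0 => by
      have := h m hm0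
      rw [Finset.sum_congr rfl fun k hk => by
        rw [hint k ((Nat.divisor_le hk).trans_lt hm) (Nat.pos_of_mem_divisors hk).ne']] at this
      exact_mod_cast this
    refine ⟨c, ?_⟩
    have h1 := h n hn
    rw [← Nat.insert_self_properDivisors hn, Finset.sum_insert Nat.self_notMem_properDivisors,
      Nat.div_self (Nat.pos_of_ne_zero hn), Nat.sub_self, pow_zero, mul_one,
      Finset.sum_congr rfl fun k hk => by
        rw [hint k (Nat.mem_properDivisors.1 hk).2 (Nat.pos_of_mem_properDivisors hk).ne']] at h1
    have h2 := congrArg (Int.cast : ℤ → ℚ) hc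
    push_cast at h2
    have hn' : (n : ℚ) ≠ 0 := Nat.cast_ne_zero.2 hn
    apply mul_left_cancel₀ hn'
    linarith

/-! ### The ghost map of an abelian compact group -/

section General

variable {G : Type*} [CommGroup G] [TopologicalSpace G] [IsTopologicalGroup G] [CompactSpace G]

theorem fixedCount_of_le {V W : OpenSubgroup G} (hVW : V ≤ W) :
    fixedCount V W = W.toSubgroup.index := by
  have h : MulAction.fixedPoints V.toSubgroup (G ⧸ W.toSubgroup) = Set.univ := by
    rw [Set.eq_univ_iff_forall]
    intro x
    obtain ⟨g, rfl⟩ := QuotientGroup.mk_surjective x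
    rintro ⟨v, hv⟩
    change (QuotientGroup.mk (v * g) : G ⧸ W.toSubgroup) = QuotientGroup.mk g
    rw [QuotientGroup.eq]
    simpa [mul_comm, mul_assoc] using hVW hv
  rw [fixedCount, h, Subgroup.index]
  exact Nat.card_congr (Equiv.Set.univ _)

theorem relIdx_eq_div {V W : OpenSubgroup G} (hVW : V ≤ W) :
    relIdx W V = V.toSubgroup.index / W.toSubgroup.index := by
  rw [← Subgroup.relIndex_mul_index (show V.toSubgroup ≤ W.toSubgroup from hVW), relIdx,
    Nat.mul_div_cancel _ (Nat.pos_of_ne_zero Subgroup.FiniteIndex.index_ne_zero)]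

theorem zeta_C (q : ℚ[X]) (V W : OpenSubgroup G) :
    zeta (C q : ℚ[X][X]) V W = C (zeta q V W) := by
  unfold zeta
  split_ifs <;> simp

theorem ghost_mu {A : Type*} [CommRing A] [Algebra ℚ A] [DecidableEq (OpenSubgroup G)] (q : A)
    (V W : OpenSubgroup G) : ghost q (fun V' => mu q V' W) V = if V = W then 1 else 0 := by
  have h := LinearEquiv.apply_symm_apply (ghostEquiv (G := G) q) (Pi.single W 1)
  have h' : ghost q (fun V' => mu q V' W) V = (Pi.single W 1 : OpenSubgroup G → A) V := by
    classical
    convert congrFun h V using 1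
    unfold mu
    change ghost q _ V = ghost q _ V
    congr! 4
  rw [h', Pi.single_apply]

/-- The inverse of a triangular matrix is triangular: by induction from larger subgroups, only the
diagonal term survives in row `V` of `ζ μ = 1`, and its coefficient is a unit. -/
theorem mu_eq_zero {A : Type*} [CommRing A] [Algebra ℚ A] (q : A) {V W : OpenSubgroup G}
    (h : ¬ V ≤ W) : mu q V W = 0 := by
  classical
  refine wf_gt.induction (C := fun V => ¬ V ≤ W → mu q V W = 0) V (fun V ih hV => ?_) h
  have h1 := ghost_mu q V W
  rw [ghost_apply_eq, Finset.sum_eq_zero, add_zero, if_neg (fun e => hV e.le)] at h1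
  · exact (isUnit_zeta_self q V).mul_right_eq_zero.1 h1
  · intro U hU
    have h2 : U ≠ V ∧ V ≤ U := by simpa using hU
    rw [ih U (lt_of_le_of_ne h2.2 (Ne.symm h2.1)) (fun h3 => hV (h2.2.trans h3)), mul_zero]

/-- The necklace vector is `μ` applied to the right-hand side, so `ζ μ = 1` applies. Triangularity
of `μ` extends all inner sums to the overgroups of `V`, which allows the sums to be exchanged. -/
theorem ghost_necklacePoly (V : OpenSubgroup G) :
    ghost (C X : ℚ[X][X]) (fun W => necklacePoly W) V =
      C (X ^ (V.toSubgroup.index - 1)) * X ^ V.toSubgroup.index := by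
  classical
  have h1 : ∀ W ∈ (finite_Ici V).toFinset, necklacePoly W =
      ∑ U ∈ (finite_Ici V).toFinset,
        C (mu (X : ℚ[X]) W U * X ^ (U.toSubgroup.index - 1)) * X ^ U.toSubgroup.index := by
    intro W hW
    have hVW : V ≤ W := by simpa using hW
    refine Finset.sum_subset (fun U hU => ?_) (fun U _ hU => ?_)
    · have hWU : W ≤ U := by simpa using hU
      simpa using hVW.trans hWU
    · have hWU : ¬ W ≤ U := by simpa using hU
      rw [mu_eq_zero _ hWU]
      simp
  have h2 : ghost (C X : ℚ[X][X]) (fun W => necklacePoly W) V =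
      ∑ W ∈ (finite_Ici V).toFinset, zeta (C X : ℚ[X][X]) V W * necklacePoly W := rfl
  rw [h2, Finset.sum_congr rfl fun W hW => by rw [h1 W hW, Finset.mul_sum], Finset.sum_comm]
  have h3 : ∀ U : OpenSubgroup G, ∑ W ∈ (finite_Ici V).toFinset, zeta (C X : ℚ[X][X]) V W *
      (C (mu (X : ℚ[X]) W U * X ^ (U.toSubgroup.index - 1)) * X ^ U.toSubgroup.index) =
      if V = U then C (X ^ (U.toSubgroup.index - 1)) * X ^ U.toSubgroup.index else 0 := by
    intro U
    have h4 : C (ghost (X : ℚ[X]) (fun W => mu X W U) V) *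
        (C (X ^ (U.toSubgroup.index - 1)) * X ^ U.toSubgroup.index : ℚ[X][X]) =
        ∑ W ∈ (finite_Ici V).toFinset, zeta (C X : ℚ[X][X]) V W *
        (C (mu (X : ℚ[X]) W U * X ^ (U.toSubgroup.index - 1)) * X ^ U.toSubgroup.index) := by
      change C (∑ W ∈ (finite_Ici V).toFinset, zeta (X : ℚ[X]) V W * mu X W U) * _ = _
      rw [map_sum, Finset.sum_mul]
      refine Finset.sum_congr rfl fun W _ => ?_
      rw [zeta_C, map_mul, map_mul]
      ring
    rw [← h4, ghost_mu]
    split_ifs <;> simp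
  rw [Finset.sum_congr rfl fun U _ => h3 U, Finset.sum_ite_eq]
  simp

/-- A family of open subgroups indexed by the positive integers, which lists every open subgroup
exactly once, according to its index, and turns divisibility into reverse inclusion. -/
structure IsIndexParam (c : ℕ+ → OpenSubgroup G) : Prop where
  index_eq : ∀ n, (c n).toSubgroup.index = n
  exists_eq : ∀ W, ∃ n, W = c n
  le_iff : ∀ n d, c n ≤ c d ↔ d ∣ n

theorem mem_pDivisors {n d : ℕ+} : d ∈ pDivisors n ↔ d ∣ n := by
  simp only [pDivisors, Finset.mem_filter, Finset.mem_Icc, and_iff_right_iff_imp]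
  exact fun h => ⟨one_le, PNat.le_of_dvd h⟩

/-- The `n`-th ghost component `∑_{d ∣ n} d q^{n/d-1} f(d)`. -/
noncomputable def necklaceSum {A : Type*} [CommRing A] (q : A) (f : ℕ+ → A) (n : ℕ+) : A :=
  ∑ d ∈ pDivisors n, ((d : ℕ) : A) * q ^ ((n : ℕ) / d - 1) * f d

theorem IsIndexParam.ghost_apply {c : ℕ+ → OpenSubgroup G} (hc : IsIndexParam c) {A : Type*}
    [CommRing A] (q : A) (y : OpenSubgroup G → A) (n : ℕ+) :
    ghost q y (c n) = necklaceSum q (fun d => y (c d)) n := by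
  change ∑ W ∈ (finite_Ici (c n)).toFinset, zeta q (c n) W * y W = _
  symm
  refine Finset.sum_bij (fun d _ => c d) (fun d hd => ?_) (fun d _ e _ h => ?_)
    (fun W hW => ?_) (fun d hd => ?_)
  · simpa [hc.le_iff] using mem_pDivisors.1 hd
  · apply PNat.eq
    rw [← hc.index_eq, h, hc.index_eq]
  · obtain ⟨d, rfl⟩ := hc.exists_eq W
    exact ⟨d, mem_pDivisors.2 (by simpa [hc.le_iff] using hW), rfl⟩
  · have hle := (hc.le_iff n d).2 (mem_pDivisors.1 hd)
    rw [zeta, if_pos hle, fixedCount_of_le hle, relIdx_eq_div hle, hc.index_eq, hc.index_eq]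

end General

/-! ### Algebra of the transform `necklaceSum` -/

section NecklaceSum

/-- The transform is triangular for divisibility, with diagonal entry `n ≠ 0`. -/
theorem necklaceSum_injective {A : Type*} [CommRing A] [IsDomain A] [CharZero A] (q : A)
    {f g : ℕ+ → A} (h : ∀ n, necklaceSum q f n = necklaceSum q g n) (n : ℕ+) : f n = g n := by
  induction n using PNat.strongInductionOn with
  | _ n ih =>
    have h1 := h n
    unfold necklaceSum at h1
    rw [← Finset.add_sum_erase _ _ (mem_pDivisors.2 (dvd_refl n)),
      ← Finset.add_sum_erase _ _ (mem_pDivisors.2 (dvd_refl n)),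
      Finset.sum_congr rfl fun d hd => by
        rw [ih d (lt_of_le_of_ne (PNat.le_of_dvd (mem_pDivisors.1 (Finset.mem_of_mem_erase hd)))
          (Finset.ne_of_mem_erase hd))]] at h1
    have h2 := add_right_cancel h1
    rw [Nat.div_self n.pos, Nat.sub_self, pow_zero, mul_one] at h2
    exact mul_left_cancel₀ (Nat.cast_ne_zero.2 n.ne_zero) h2

theorem map_necklaceSum {A B : Type*} [CommRing A] [CommRing B] (φ : A →+* B) (q : A)
    (f : ℕ+ → A) (n : ℕ+) :
    φ (necklaceSum q f n) = necklaceSum (φ q) (fun d => φ (f d)) n := by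
  simp [necklaceSum]

theorem sum_divisors_toPNat' {A : Type*} [AddCommMonoid A] (f : ℕ+ → A) (n : ℕ+) :
    ∑ k ∈ (n : ℕ).divisors, f k.toPNat' = ∑ d ∈ pDivisors n, f d := by
  refine Finset.sum_bij' (fun k _ => k.toPNat') (fun d _ => (d : ℕ)) (fun k hk => ?_)
    (fun d hd => ?_) (fun k hk => ?_) (fun d _ => PNat.coe_toPNat' d) (fun _ _ => rfl)
  · rw [mem_pDivisors, PNat.dvd_iff, Nat.toPNat'_coe, if_pos (Nat.pos_of_mem_divisors hk)]
    exact Nat.dvd_of_mem_divisors hk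
  · rw [Nat.mem_divisors]
    exact ⟨PNat.dvd_iff.1 (mem_pDivisors.1 hd), n.ne_zero⟩
  · rw [Nat.toPNat'_coe, if_pos (Nat.pos_of_mem_divisors hk)]

/-- Substitution `e = d * k`. -/
theorem sum_pDivisors_sum_pDivisors {A : Type*} [AddCommMonoid A] (F : ℕ+ → ℕ+ → A) (n : ℕ+) :
    ∑ e ∈ pDivisors n, ∑ d ∈ pDivisors e, F e d =
      ∑ d ∈ pDivisors n, ∑ k ∈ pDivisors (PNat.divExact n d), F (d * k) d := by
  classical
  rw [Finset.sum_comm' (t' := pDivisors n) (s' := fun d => (pDivisors n).filter (d ∣ ·))]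
  · refine Finset.sum_congr rfl fun d hd => ?_
    have hdn := PNat.mul_div_exact (mem_pDivisors.1 hd)
    symm
    refine Finset.sum_bij (fun k _ => d * k) (fun k hk => ?_) (fun k _ l _ h => ?_)
      (fun e he => ?_) (fun _ _ => rfl)
    · rw [Finset.mem_filter, mem_pDivisors]
      refine ⟨?_, dvd_mul_right _ _⟩
      rw [← hdn]
      exact mul_dvd_mul_left _ (mem_pDivisors.1 hk)
    · exact mul_left_cancel h
    · rw [Finset.mem_filter, mem_pDivisors] at he
      obtain ⟨he, k, rfl⟩ := he
      refine ⟨k, mem_pDivisors.2 ?_, rfl⟩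
      obtain ⟨l, hl⟩ := he
      refine ⟨l, mul_left_cancel (a := d) ?_⟩
      rw [hdn, hl, mul_assoc]
  · intro e d
    simp only [Finset.mem_filter, mem_pDivisors]
    exact ⟨fun h => ⟨h, h.2.trans h.1⟩, fun h => h.1⟩

theorem exists_int_eq_of_necklaceSum (q x : ℤ) (p : ℕ+ → ℚ)
    (h : ∀ n : ℕ+, necklaceSum (q : ℚ) p n = (q : ℚ) ^ ((n : ℕ) - 1) * (x : ℚ) ^ (n : ℕ))
    (n : ℕ+) : ∃ m : ℤ, p n = m := by
  have h1 := exists_int_eq_of_necklace_relation q x (fun k => p k.toPNat') (fun n hn => ?_) n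
    n.ne_zero
  · simpa using h1
  · obtain ⟨m, rfl⟩ : ∃ m : ℕ+, (m : ℕ) = n := 
      CanLift.prf n (Nat.pos_of_ne_zero hn)
    rw [← h m, necklaceSum, ← sum_divisors_toPNat']
    refine Finset.sum_congr rfl fun k hk => ?_
    rw [Nat.toPNat'_coe, if_pos (Nat.pos_of_mem_divisors hk)]

/-- If the components of `P d` solve the necklace relation at `q, q^{s d}`, then composing with a
solution `M` at `y` twists the ghost components by `q^{s n}`. -/
theorem necklaceSum_twist {A : Type*} [CommRing A] (q y : A) (s : ℕ) (P : ℕ+ → ℕ+ → A)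
    (M : ℕ+ → A)
    (hP : ∀ d n : ℕ+, necklaceSum q (P d) n = q ^ ((n : ℕ) - 1) * (q ^ (s * d)) ^ (n : ℕ))
    (hM : ∀ n : ℕ+, necklaceSum q M n = q ^ ((n : ℕ) - 1) * y ^ (n : ℕ)) (n : ℕ+) :
    necklaceSum q (fun e => ∑ d ∈ pDivisors e, P d (PNat.divExact e d) * M d) n =
      q ^ (s * n) * (q ^ ((n : ℕ) - 1) * y ^ (n : ℕ)) := by
  rw [← hM, necklaceSum, necklaceSum.eq_def q M, Finset.mul_sum]
  simp only [Finset.mul_sum]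
  rw [sum_pDivisors_sum_pDivisors (fun e d => ((e : ℕ) : A) * q ^ ((n : ℕ) / e - 1) *
    (P d (PNat.divExact e d) * M d))]
  refine Finset.sum_congr rfl fun d hd => ?_
  have hdn := PNat.mul_div_exact (mem_pDivisors.1 hd)
  set m := PNat.divExact n d with hm
  have hnm : (n : ℕ) = d * m := by rw [← hdn, PNat.mul_coe]
  have h1 := hP d m
  rw [necklaceSum] at h1
  -- As `n/(dk) = m/k`, the inner sum is `d M_d` times the `m`-th ghost component of `P d`.
  have h2 : ∑ k ∈ pDivisors m, (((d * k : ℕ+) : ℕ) : A) * q ^ ((n : ℕ) / (d * k : ℕ+) - 1) *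
      (P d (PNat.divExact (d * k) d) * M d) =
      (d : ℕ) * M d * ∑ k ∈ pDivisors m, ((k : ℕ) : A) * q ^ ((m : ℕ) / k - 1) * P d k := by
    rw [Finset.mul_sum]
    refine Finset.sum_congr rfl fun k _ => ?_
    have h3 : PNat.divExact (d * k) d = k :=
      mul_left_cancel (PNat.mul_div_exact (dvd_mul_right d k))
    rw [h3, hnm, PNat.mul_coe, Nat.mul_div_mul_left _ _ d.pos]
    push_cast
    ring
  rw [h2, h1, hnm, Nat.mul_div_cancel_left _ d.pos, ← pow_mul, mul_assoc s]
  ring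

end NecklaceSum

/-! ### Open subgroups of `Ĉ` -/

section Cyclic

/-- The dense image of `C` meets every coset of an open subgroup. -/
theorem isCyclic_quotient (W : OpenSubgroup CHat) : IsCyclic (CHat ⧸ W.toSubgroup) := by
  refine isCyclic_of_surjective ((QuotientGroup.mk' W.toSubgroup).comp etaHom) fun y => ?_
  obtain ⟨g, rfl⟩ := QuotientGroup.mk_surjective y
  have hopen : IsOpen ((fun h : CHat => h⁻¹ * g) ⁻¹' (W : Set CHat)) :=
    W.isOpen.preimage (by fun_prop)
  obtain ⟨k, hk⟩ := denseRange_etaHom.exists_mem_open hopen ⟨g, by simp⟩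
  exact ⟨k, QuotientGroup.eq.2 hk⟩

/-- An element of the completion is a compatible family over the finite quotients of `C`; the map is
projection to the component at `nℤ`. -/
theorem exists_surjective_zmod (n : ℕ+) :
    ∃ π : CHat →* Multiplicative (ZMod n), Function.Surjective π := by
  let f : Multiplicative ℤ →* Multiplicative (ZMod n) := (Int.castAddHom (ZMod n)).toMultiplicative
  have hf : Function.Surjective f := ZMod.intCast_surjective
  let K : FiniteIndexNormalSubgroup (GrpCat.of (Multiplicative ℤ)) :=
    { toSubgroup := f.ker
      isNormal' := inferInstance
      isFiniteIndex' := inferInstance }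
  let ρ : CHat →* Multiplicative ℤ ⧸ f.ker :=
    { toFun := fun g => g.1 K, map_one' := rfl, map_mul' := fun _ _ => rfl }
  refine ⟨(QuotientGroup.kerLift f).comp ρ, fun y => ?_⟩
  obtain ⟨k, rfl⟩ := hf y
  exact ⟨etaHom k, rfl⟩

/-- The quotient is cyclic and killed by `n`, so its order divides `n`; conversely, a surjection
onto `ℤ/n` kills all `n`-th powers. -/
theorem index_cHatPow (n : ℕ+) : (cHatPow n).toSubgroup.index = n := by
  apply Nat.dvd_antisymm
  · have := isCyclic_quotient (cHatPow n)
    rw [Subgroup.index, ← IsCyclic.exponent_eq_card]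
    refine Monoid.exponent_dvd_of_forall_pow_eq_one fun y => ?_
    obtain ⟨g, rfl⟩ := QuotientGroup.mk_surjective y
    exact (QuotientGroup.eq_one_iff _).2 ⟨g, rfl⟩
  · obtain ⟨π, hπ⟩ := exists_surjective_zmod n
    have hcard : Nat.card (Multiplicative (ZMod n)) = n := Nat.card_zmod n
    have h1 : π.ker.index = n := by
      rw [Subgroup.index_ker, MonoidHom.range_eq_top.2 hπ, Subgroup.card_top, hcard]
    rw [← h1]
    refine Subgroup.index_dvd_of_le ?_
    rintro _ ⟨g, rfl⟩
    rw [MonoidHom.mem_ker, powMonoidHom_apply, map_pow]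
    exact orderOf_dvd_iff_pow_eq_one.1 ((orderOf_dvd_natCard (π g)).trans hcard.dvd)

theorem cHatPow_le_of_dvd {n d : ℕ+} (h : d ∣ n) : cHatPow n ≤ cHatPow d := by
  obtain ⟨k, rfl⟩ := h
  rintro _ ⟨g, rfl⟩
  refine ⟨g ^ (k : ℕ), ?_⟩
  simp only [powMonoidHom_apply, PNat.mul_coe]
  rw [← pow_mul, mul_comm]

theorem isIndexParam_cHatPow : IsIndexParam cHatPow where
  index_eq := index_cHatPow
  exists_eq W := by
    obtain ⟨n, hn⟩ : ∃ n : ℕ+, (n : ℕ) = W.toSubgroup.index :=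
      CanLift.prf _ (Nat.pos_of_ne_zero Subgroup.FiniteIndex.index_ne_zero)
    -- A subgroup of index `n` contains all `n`-th powers; equality of indices then forces `W = Ĉⁿ`.
    have hle : cHatPow n ≤ W := by
      rintro _ ⟨g, rfl⟩
      rw [hn]
      exact Subgroup.pow_index_mem W.toSubgroup g
    refine ⟨n, (hle.lt_or_eq.resolve_left fun h => ?_).symm⟩
    have := index_lt h
    rw [index_cHatPow, hn] at this
    exact lt_irrefl _ this
  le_iff n d := by
    refine ⟨fun h => ?_, cHatPow_le_of_dvd⟩
    rw [PNat.dvd_iff, ← index_cHatPow n, ← index_cHatPow d]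
    exact Subgroup.index_dvd_of_le h

theorem toAmbient_injective {G : Type*} [CommGroup G] [TopologicalSpace G] [IsTopologicalGroup G]
    [CompactSpace G] (U : OpenSubgroup G) : Function.Injective (toAmbient U) := by
  intro W W' h
  have h1 : W.toSubgroup.map U.toSubgroup.subtype = W'.toSubgroup.map U.toSubgroup.subtype :=
    congrArg OpenSubgroup.toSubgroup h
  exact OpenSubgroup.toSubgroup_injective
    (Subgroup.map_injective U.toSubgroup.subtype_injective h1)

theorem toAmbient_cHatPowIn (r n : ℕ+) :
    toAmbient (cHatPow r) (cHatPowIn r n) = cHatPow (r * n) := by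
  ext g
  constructor
  · rintro ⟨u, hu, rfl⟩
    exact hu
  · intro hg
    exact ⟨⟨g, cHatPow_le_of_dvd (dvd_mul_right r n) hg⟩, hg, rfl⟩

theorem isIndexParam_cHatPowIn (r : ℕ+) : IsIndexParam (cHatPowIn r) where
  index_eq n := by
    have h1 : (cHatPowIn r n).toSubgroup.index =
        (cHatPow (r * n)).toSubgroup.relIndex (cHatPow r).toSubgroup := rfl
    have h2 := Subgroup.relIndex_mul_index
      (show (cHatPow (r * n)).toSubgroup ≤ (cHatPow r).toSubgroup from
        cHatPow_le_of_dvd (dvd_mul_right r n))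
    rw [index_cHatPow, index_cHatPow, PNat.mul_coe, mul_comm] at h2
    rw [h1]
    exact Nat.eq_of_mul_eq_mul_left r.pos h2
  exists_eq W := by
    obtain ⟨m, hm⟩ := isIndexParam_cHatPow.exists_eq (toAmbient (cHatPow r) W)
    have hle : cHatPow m ≤ cHatPow r := by
      rw [← hm]
      rintro _ ⟨u, _, rfl⟩
      exact u.2
    obtain ⟨n, rfl⟩ := (isIndexParam_cHatPow.le_iff m r).1 hle
    exact ⟨n, toAmbient_injective _ (by rw [hm, toAmbient_cHatPowIn])⟩
  le_iff n d := by
    have h : cHatPowIn r n ≤ cHatPowIn r d ↔ cHatPow (r * n) ≤ cHatPow (r * d) := by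
      refine ⟨fun h g hg => ?_, fun h g hg => h hg⟩
      exact @h ⟨g, cHatPow_le_of_dvd (dvd_mul_right r n) hg⟩ hg
    rw [h, isIndexParam_cHatPow.le_iff, PNat.dvd_iff, PNat.dvd_iff, PNat.mul_coe, PNat.mul_coe,
      Nat.mul_dvd_mul_iff_left r.pos]

/-! ### `q`-necklace polynomials -/

theorem necklaceSum_qNecklace (n : ℕ+) :
    necklaceSum (C X : ℚ[X][X]) qNecklace n = C X ^ ((n : ℕ) - 1) * X ^ (n : ℕ) := by
  have h := ghost_necklacePoly (cHatPow n)
  rw [isIndexParam_cHatPow.ghost_apply, index_cHatPow, C_pow] at h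
  exact h

theorem necklaceSum_eval_qNecklace (y : ℚ[X]) (n : ℕ+) :
    necklaceSum (X : ℚ[X]) (fun d => (qNecklace d).eval y) n =
      X ^ ((n : ℕ) - 1) * y ^ (n : ℕ) := by
  simpa using ((map_necklaceSum (evalRingHom y) (C X) qNecklace n).symm.trans
    (congrArg (evalRingHom y) (necklaceSum_qNecklace n)))

theorem isNumerical_eval_qNecklace (y : ℤ[X]) (n : ℕ+) :
    IsNumerical ((qNecklace n).eval (y.map (Int.castRingHom ℚ))) := by
  intro k
  refine exists_int_eq_of_necklaceSum k (y.eval k)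
    (fun d => ((qNecklace d).eval (y.map (Int.castRingHom ℚ))).eval (k : ℚ)) (fun m => ?_) n
  simpa using ((map_necklaceSum (evalRingHom (k : ℚ)) X _ m).symm.trans
    (congrArg (evalRingHom (k : ℚ)) (necklaceSum_eval_qNecklace (y.map (Int.castRingHom ℚ)) m)))

theorem necklaceSum_comp_qNecklace (r n : ℕ+) :
    necklaceSum (C X : ℚ[X][X]) (fun d => (qNecklace d).comp (X ^ (r : ℕ))) n =
      C X ^ ((n : ℕ) - 1) * (X ^ (r : ℕ)) ^ (n : ℕ) := by
  simpa using ((map_necklaceSum (compRingHom (X ^ (r : ℕ))) (C X) qNecklace n).symm.trans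
    (congrArg (compRingHom (X ^ (r : ℕ))) (necklaceSum_qNecklace n)))

/-- On ghost components, `q`-restriction only reindexes: component `n` over `Ĉʳ` is component `rn`
over `Ĉ`. -/
theorem necklaceSum_fOp_necklacePoly (r n : ℕ+) :
    necklaceSum (C X : ℚ[X][X]) (fOp r (fun V => necklacePoly V)) n =
      C X ^ ((r * n : ℕ) - 1) * X ^ (r * n : ℕ) := by
  have h1 := (isIndexParam_cHatPowIn r).ghost_apply (C X : ℚ[X][X])
    (qRes (C X) (cHatPow r) (fun V => necklacePoly V)) n
  have h2 : ghost (C X : ℚ[X][X]) (qRes (C X) (cHatPow r) (fun V => necklacePoly V)) =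
      ghostRes (cHatPow r) (ghost (C X) (fun V => necklacePoly V)) :=
    LinearEquiv.apply_symm_apply (ghostEquiv (C X : ℚ[X][X])) _
  refine h1.symm.trans ?_
  rw [h2, ghostRes, toAmbient_cHatPowIn, ghost_necklacePoly, index_cHatPow, C_pow, PNat.mul_coe]

end Cyclic

end QNecklace

theorem mainTheorem7 :
    ∃ Q : ℕ+ → ℕ+ → ℕ+ → ℚ[X],
      (∀ r n d : ℕ+, d ∣ n → QNecklace.IsNumerical (Q r n d)) ∧
      ∀ r n : ℕ+,
        QNecklace.fOp r (fun V => QNecklace.necklacePoly V) n =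
          ∑ d ∈ QNecklace.pDivisors n,
            C (Q r n d) * (QNecklace.qNecklace d).comp (X ^ (r : ℕ)) := by
  -- The argument `q^((r-1)d)` is chosen so that its `n/d`-th power is the missing factor
  -- `q^((r-1)n)`.
  refine ⟨fun r n d => (QNecklace.qNecklace (PNat.divExact n d)).eval (X ^ (((r : ℕ) - 1) * d)),
    fun r n d _ => ?_, fun r n => ?_⟩
  · simpa using QNecklace.isNumerical_eval_qNecklace (X ^ (((r : ℕ) - 1) * d)) (PNat.divExact n d)
  · refine QNecklace.necklaceSum_injective (C X : ℚ[X][X])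
      (g := fun n => ∑ d ∈ QNecklace.pDivisors n,
        C ((QNecklace.qNecklace (PNat.divExact n d)).eval (X ^ (((r : ℕ) - 1) * d))) *
          (QNecklace.qNecklace d).comp (X ^ (r : ℕ))) (fun m => ?_) n
    rw [QNecklace.necklaceSum_fOp_necklacePoly]
    refine Eq.symm ((QNecklace.necklaceSum_twist (C X : ℚ[X][X]) (X ^ (r : ℕ)) ((r : ℕ) - 1)
      (fun d k => C ((QNecklace.qNecklace k).eval (X ^ (((r : ℕ) - 1) * d)))) _ (fun d k => ?_)
      (QNecklace.necklaceSum_comp_qNecklace r) m).trans ?_)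
    · rw [← QNecklace.map_necklaceSum, QNecklace.necklaceSum_eval_qNecklace]
      simp
    -- The exponents of `q` agree: `(r-1)m + (m-1) = rm - 1`.
    · rw [← mul_assoc, ← pow_add, ← pow_mul]
      congr 2
      have h1 := r.pos
      have h2 := m.pos
      obtain ⟨s, hs⟩ := Nat.exists_eq_add_of_le' h1
      rw [hs, Nat.add_sub_cancel, add_mul, Nat.succ_mul, zero_mul, zero_add, Nat.add_sub_assoc h2]
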